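/- A $(\vee,0)$-semilattice $S$ (a join-semilattice with least element $0$) is called distributive if, whenever $c\le a\vee b$ in $S$, there are $x\le a$ and $y\le b$ in $S$ with $c=x\vee y$. A lattice-ordered group ($\ell$-group), not necessarily commutative, is a group $G$ endowed with a lattice order such that both left and right translations are order-preserving. An $\ell$-ideal of $G$ is a normal subgroup of $G$ that is also a sublattice of $G$ and is convex ($x,z\in I$ and $x\le y\le z$ imply $y\in I$); it is finitely generated if it is the least $\ell$-ideal containing some finite subset of $G$. The $\ell$-ideals of $G$ form a lattice under inclusion, and the finitely generated ones form a $(\vee,0)$-semilattice. (i) Every distributive $(\vee,0)$-semilattice that is at most countable is isomorphic to the $(\vee,0)$-semilattice of all finitely generated $\ell$-ideals of some $\ell$-group. (ii) Equivalently, every distributive algebraic lattice (that is, every distributive complete lattice in which each element is a join of compact elements) with at most countably many compact elements is isomorphic to the lattice of all $\ell$-ideals of some $\ell$-group. -/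

import Mathlib

universe u

/-- A join-semilattice is distributive if every element below a join `a ⊔ b` splits as a join of an
element below `a` and an element below `b`. -/
def IsDistribSemilattice (S : Type u) [SemilatticeSup S] : Prop :=
  ∀ a b c : S, c ≤ a ⊔ b → ∃ x y : S, x ≤ a ∧ y ≤ b ∧ c = x ⊔ y

/-- An `ℓ`-ideal of a lattice-ordered group (not assumed commutative): a normal subgroup that is
also a sublattice and is convex. -/
@[ext]
structure LIdeal (G : Type u) [Group G] [Lattice G] where
  /-- The underlying set. -/
  carrier : Set G
  one_mem : 1 ∈ carrier
  mul_mem : ∀ {x y : G}, x ∈ carrier → y ∈ carrier → x * y ∈ carrier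
  inv_mem : ∀ {x : G}, x ∈ carrier → x⁻¹ ∈ carrier
  conj_mem : ∀ {x : G}, x ∈ carrier → ∀ g : G, g * x * g⁻¹ ∈ carrier
  sup_mem : ∀ {x y : G}, x ∈ carrier → y ∈ carrier → x ⊔ y ∈ carrier
  inf_mem : ∀ {x y : G}, x ∈ carrier → y ∈ carrier → x ⊓ y ∈ carrier
  convex : ∀ {x y z : G}, x ∈ carrier → z ∈ carrier → x ≤ y → y ≤ z → y ∈ carrier

namespace LIdeal

variable {G : Type u} [Group G] [Lattice G]

instance : SetLike (LIdeal G) G where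
  coe := LIdeal.carrier
  coe_injective := fun _ _ h => LIdeal.ext h

/-- `ℓ`-ideals are ordered by inclusion. -/
instance : PartialOrder (LIdeal G) := .ofSetLike (LIdeal G) G

instance : InfSet (LIdeal G) where
  sInf A :=
    { carrier := {x | ∀ I ∈ A, x ∈ I}
      one_mem := fun I _ => I.one_mem
      mul_mem := fun hx hy I hI => I.mul_mem (hx I hI) (hy I hI)
      inv_mem := fun hx I hI => I.inv_mem (hx I hI)
      conj_mem := fun hx g I hI => I.conj_mem (hx I hI) g
      sup_mem := fun hx hy I hI => I.sup_mem (hx I hI) (hy I hI)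
      inf_mem := fun hx hy I hI => I.inf_mem (hx I hI) (hy I hI)
      convex := fun hx hz hxy hyz I hI => I.convex (hx I hI) (hz I hI) hxy hyz }

theorem isGLB_sInf (A : Set (LIdeal G)) : IsGLB A (sInf A) :=
  ⟨fun I hI _ hx => hx I hI, fun _ hJ _ hx _ hI => hJ hI hx⟩

/-- The lattice of all `ℓ`-ideals of `G` under inclusion; infima are intersections. -/
instance : CompleteLattice (LIdeal G) := completeLatticeOfInf (LIdeal G) isGLB_sInf

/-- The `ℓ`-ideal generated by a set `X`: the least `ℓ`-ideal containing `X`. -/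
def closure (X : Set G) : LIdeal G := sInf {I | X ⊆ (I : Set G)}

/-- An `ℓ`-ideal is finitely generated if it is the least one containing some finite set. -/
def FG (I : LIdeal G) : Prop := ∃ X : Set G, X.Finite ∧ closure X = I

theorem subset_closure (X : Set G) : X ⊆ (closure X : Set G) :=
  fun _ hx _ hI => hI hx

theorem closure_le {X : Set G} {I : LIdeal G} : closure X ≤ I ↔ X ⊆ (I : Set G) :=
  ⟨fun h _ hx => h (subset_closure X hx), fun h _ hx => hx I h⟩

theorem FG.sup {I J : LIdeal G} (hI : I.FG) (hJ : J.FG) : (I ⊔ J).FG := by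
  obtain ⟨X, hX, rfl⟩ := hI
  obtain ⟨Y, hY, rfl⟩ := hJ
  refine ⟨X ∪ Y, hX.union hY, le_antisymm ?_ (sup_le ?_ ?_)⟩
  · exact closure_le.2 (Set.union_subset (closure_le.1 le_sup_left) (closure_le.1 le_sup_right))
  · exact closure_le.2 (Set.subset_union_left.trans (subset_closure _))
  · exact closure_le.2 (Set.subset_union_right.trans (subset_closure _))

theorem fg_bot : (⊥ : LIdeal G).FG :=
  ⟨∅, Set.finite_empty, le_bot_iff.1 (closure_le.2 (Set.empty_subset _))⟩

variable (G) in
/-- The finitely generated `ℓ`-ideals of `G`, ordered by inclusion. -/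
def FinGen : Type u := {I : LIdeal G // I.FG}

/-- The finitely generated `ℓ`-ideals form a join-semilattice, with joins taken in the lattice of
all `ℓ`-ideals. -/
instance : SemilatticeSup (FinGen G) :=
  Subtype.semilatticeSup fun _ _ hI hJ => FG.sup hI hJ

/-- The zero of the semilattice of finitely generated `ℓ`-ideals is the zero `ℓ`-ideal. -/
instance : OrderBot (FinGen G) where
  bot := ⟨⊥, fg_bot⟩
  bot_le I := (bot_le : ⊥ ≤ I.1)

end LIdeal

/-! The semilattice is exhausted by finite sets `F k`, each generator being split into finitely many
smaller elements with the same join. By distributivity the splitting can be chosen so that every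
inequality between joins of subsets of `F k` becomes an inclusion of the split sets. Thus `S` is a
limit of finite powerset semilattices, and it remains to realize this limit by `ℓ`-groups.

The building block is the group of bounded automorphisms of the chain `ℚ`. Conjugates of the
absolute value of any nontrivial element dominate every member (`exists_boundedAut_mabs_le_conj`),
so the block has no proper nonzero `ℓ`-ideals, and in a finite power an `ℓ`-ideal is determined by a
set of coordinates. A countable power of automorphism groups embeds back into one block
(`exists_embedding_pi_boundedAut`). The transition maps built from this embedding act on supports
exactly by the splitting (`supp_step`), so the join of the support is preserved and assigns to each
limit element a value in `S`.

If one value is below another, one further stage turns this into inclusion of supports, which gives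
domination by a conjugate (`Limit.exists_mabs_le_conj`). Hence `ℓ`-ideals of the limit are ideals of
`S`, and finitely generated ones are principal. For the second claim, a compactly generated lattice
is the ideal lattice of its compact elements. -/

/-- A map from an `ℓ`-group onto a join-semilattice whose sublevel sets are the principal
`ℓ`-ideals: the value of `x` plays the role of the `ℓ`-ideal generated by `x`. -/
structure IdealValuation (G S : Type u) [Group G] [Lattice G] [SemilatticeSup S] [OrderBot S] where
  /-- The underlying map. -/
  val : G → S
  val_one : val 1 = ⊥
  val_mul : ∀ x y, val (x * y) ≤ val x ⊔ val y
  val_inv : ∀ x, val x⁻¹ ≤ val x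
  val_conj : ∀ g x, val (g * x * g⁻¹) ≤ val x
  val_sup : ∀ x y, val (x ⊔ y) ≤ val x ⊔ val y
  val_inf : ∀ x y, val (x ⊓ y) ≤ val x ⊔ val y
  val_convex : ∀ x y z, x ≤ y → y ≤ z → val y ≤ val x ⊔ val z
  surjective : Function.Surjective val
  dominated : ∀ x y, val y ≤ val x → ∃ f, |y|ₘ ≤ f * |x|ₘ * f⁻¹

namespace LIdeal

variable {G : Type u} [Group G] [Lattice G]

theorem mem_of_mabs_le [MulLeftMono G] [MulRightMono G] (I : LIdeal G) {x y : G} (hx : x ∈ I)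
    (h : |y|ₘ ≤ x) : y ∈ I := by
  refine I.convex (I.inv_mem hx) hx ?_ ((le_mabs_self y).trans h)
  exact inv_le_of_inv_le' ((inv_le_mabs y).trans h)

theorem mabs_mem (I : LIdeal G) {x : G} (hx : x ∈ I) : |x|ₘ ∈ I :=
  I.sup_mem hx (I.inv_mem hx)

end LIdeal

namespace IdealValuation

variable {G S : Type u} [Group G] [Lattice G] [SemilatticeSup S] [OrderBot S]

/-- The `ℓ`-ideal of elements with value in a given ideal of the semilattice. -/
def preimage (v : IdealValuation G S) (J : Order.Ideal S) : LIdeal G where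
  carrier := {x | v.val x ∈ J}
  one_mem := by simp [v.val_one]
  mul_mem hx hy := J.lower (v.val_mul _ _) (Order.Ideal.sup_mem hx hy)
  inv_mem hx := J.lower (v.val_inv _) hx
  conj_mem hx g := J.lower (v.val_conj g _) hx
  sup_mem hx hy := J.lower (v.val_sup _ _) (Order.Ideal.sup_mem hx hy)
  inf_mem hx hy := J.lower (v.val_inf _ _) (Order.Ideal.sup_mem hx hy)
  convex hx hz hxy hyz := J.lower (v.val_convex _ _ _ hxy hyz) (Order.Ideal.sup_mem hx hz)

theorem mem_preimage (v : IdealValuation G S) {J : Order.Ideal S} {x : G} :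
    x ∈ v.preimage J ↔ v.val x ∈ J := Iff.rfl

theorem preimage_le_preimage (v : IdealValuation G S) {J K : Order.Ideal S} :
    v.preimage J ≤ v.preimage K ↔ J ≤ K := by
  refine ⟨fun h s hs => ?_, fun h x hx => h hx⟩
  obtain ⟨x, rfl⟩ := v.surjective s
  exact h (v.mem_preimage.2 hs)

variable [MulLeftMono G] [MulRightMono G]

theorem mem_of_val_le (v : IdealValuation G S) (I : LIdeal G) {x y : G} (hx : x ∈ I)
    (h : v.val y ≤ v.val x) : y ∈ I := by
  obtain ⟨f, hf⟩ := v.dominated x y h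
  exact I.mem_of_mabs_le (I.conj_mem (I.mabs_mem hx) f) hf

theorem val_le_of_mabs_le (v : IdealValuation G S) {x y : G} (h : |y|ₘ ≤ x) :
    v.val y ≤ v.val x :=
  Order.Ideal.mem_principal.1 ((v.preimage (.principal (v.val x))).mem_of_mabs_le
    (v.mem_preimage.2 Order.Ideal.mem_principal_self) h)

/-- An `ℓ`-ideal contains with `x` everything of smaller value, by domination, so it is the full
preimage of its image. That image is directed because `|x|ₘ ⊔ |y|ₘ` has value above those of `x` and
`y`. -/
theorem preimage_surjective (v : IdealValuation G S) : Function.Surjective v.preimage := by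
  intro I
  refine ⟨⟨⟨v.val '' (I : Set G), ?_⟩, ⟨_, 1, I.one_mem, rfl⟩, ?_⟩, ?_⟩
  · rintro _ s hs ⟨x, hx, rfl⟩
    obtain ⟨y, rfl⟩ := v.surjective s
    exact ⟨y, v.mem_of_val_le I hx hs, rfl⟩
  · rintro _ ⟨x, hx, rfl⟩ _ ⟨y, hy, rfl⟩
    exact ⟨_, ⟨|x|ₘ ⊔ |y|ₘ, I.sup_mem (I.mabs_mem hx) (I.mabs_mem hy), rfl⟩,
      v.val_le_of_mabs_le le_sup_left, v.val_le_of_mabs_le le_sup_right⟩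
  · refine SetLike.ext fun y => ?_
    constructor
    · rintro ⟨x, hx, hxy⟩
      exact v.mem_of_val_le I hx hxy.ge
    · exact fun hy => ⟨y, hy, rfl⟩

/-- The `ℓ`-ideals correspond to the ideals of the value semilattice. -/
noncomputable def idealIso (v : IdealValuation G S) : Order.Ideal S ≃o LIdeal G :=
  RelIso.ofSurjective
    (OrderEmbedding.ofMapLEIff v.preimage fun _ _ => v.preimage_le_preimage) v.preimage_surjective

theorem closure_singleton (v : IdealValuation G S) (x : G) :
    LIdeal.closure {x} = v.preimage (.principal (v.val x)) := by
  refine le_antisymm (LIdeal.closure_le.2 ?_) fun y hy => ?_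
  · exact Set.singleton_subset_iff.2 (v.mem_preimage.2 Order.Ideal.mem_principal_self)
  · exact v.mem_of_val_le _ (LIdeal.subset_closure _ rfl) (Order.Ideal.mem_principal.1 hy)

theorem closure_finset (v : IdealValuation G S) (X : Finset G) :
    LIdeal.closure (X : Set G) = v.preimage (.principal (X.sup v.val)) := by
  obtain ⟨J, hJ⟩ := v.preimage_surjective (LIdeal.closure (X : Set G))
  refine le_antisymm (LIdeal.closure_le.2 fun x hx => ?_) ?_
  · exact v.mem_preimage.2 (Order.Ideal.mem_principal.2 (Finset.le_sup (f := v.val) hx))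
  · rw [← hJ, v.preimage_le_preimage, Order.Ideal.principal_le_iff]
    refine (Order.Ideal.finsetSup_mem_iff J).2 fun x hx => ?_
    rw [← v.mem_preimage, hJ]
    exact LIdeal.subset_closure _ hx

/-- The finitely generated `ℓ`-ideals correspond to the elements of the value semilattice. -/
noncomputable def finGenIso (v : IdealValuation G S) : S ≃o LIdeal.FinGen G :=
  RelIso.ofSurjective
    (OrderEmbedding.ofMapLEIff
      (fun s => ⟨v.preimage (.principal s), by
        obtain ⟨x, rfl⟩ := v.surjective s
        exact ⟨{x}, Set.finite_singleton x, v.closure_singleton x⟩⟩)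
      fun s t => v.preimage_le_preimage.trans (by simp)) (by
    rintro ⟨I, X, hX, rfl⟩
    lift X to Finset G using hX
    exact ⟨X.sup v.val, Subtype.ext (v.closure_finset X).symm⟩)

end IdealValuation

/-! ### Compact elements of a distributive algebraic lattice. -/

section CompactElements

variable (L : Type u) [CompleteLattice L]

/-- The compact elements of a complete lattice. -/
def CompactElements : Type u := {k : L // IsCompactElement k}

theorem isCompactElement_sup {L : Type u} [CompleteLattice L] {a b : L} (ha : IsCompactElement a)
    (hb : IsCompactElement b) : IsCompactElement (a ⊔ b) := by
  classical
  have := CompleteLattice.isCompactElement_finsetSup (f := id) ({a, b} : Finset L)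
    (by simp [ha, hb])
  simpa using this

theorem isCompactElement_bot {L : Type u} [CompleteLattice L] : IsCompactElement (⊥ : L) := by
  have := CompleteLattice.isCompactElement_finsetSup (f := id) (∅ : Finset L) (by simp)
  simpa using this

instance : SemilatticeSup (CompactElements L) :=
  Subtype.semilatticeSup fun _ _ => isCompactElement_sup

instance : OrderBot (CompactElements L) where
  bot := ⟨⊥, isCompactElement_bot⟩
  bot_le k := (bot_le : ⊥ ≤ k.1)

variable {L}

/-- Distributivity gives `c = (c ⊓ a) ⊔ (c ⊓ b)`, but these meets need not be compact. Compactness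
of `c` selects finitely many compact elements below one meet or the other, and the joins of the two
groups are the required pieces. -/
theorem CompactElements.isDistribSemilattice [IsCompactlyGenerated L]
    (h : ∀ a b c : L, a ⊓ (b ⊔ c) = (a ⊓ b) ⊔ (a ⊓ c)) :
    IsDistribSemilattice (CompactElements L) := by
  classical
  rintro ⟨a, ha⟩ ⟨b, hb⟩ ⟨c, hc⟩ (hle : c ≤ a ⊔ b)
  set T : Set L := {k | IsCompactElement k ∧ (k ≤ c ⊓ a ∨ k ≤ c ⊓ b)} with hT
  have hcT : c ≤ sSup T := by
    calc c = c ⊓ a ⊔ c ⊓ b := by rw [← h, inf_eq_left.2 hle]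
      _ ≤ sSup T := by
        rw [← sSup_compact_le_eq (c ⊓ a), ← sSup_compact_le_eq (c ⊓ b)]
        exact sup_le (sSup_le_sSup fun k hk => ⟨hk.1, .inl hk.2⟩)
          (sSup_le_sSup fun k hk => ⟨hk.1, .inr hk.2⟩)
  obtain ⟨t, htT, hct⟩ :=
    (CompleteLattice.isCompactElement_iff_exists_le_sSup_of_le_sSup L c).1 hc T hcT
  have hcpt (p : L → Prop) : IsCompactElement ((t.filter p).sup id) :=
    CompleteLattice.isCompactElement_finsetSup _ fun x hx => (htT (Finset.mem_filter.1 hx).1).1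
  have hle1 : (t.filter (· ≤ c ⊓ a)).sup id ≤ c ⊓ a :=
    Finset.sup_le fun x hx => (Finset.mem_filter.1 hx).2
  have hle2 : (t.filter (· ≤ c ⊓ b)).sup id ≤ c ⊓ b :=
    Finset.sup_le fun x hx => (Finset.mem_filter.1 hx).2
  refine ⟨⟨_, hcpt (· ≤ c ⊓ a)⟩, ⟨_, hcpt (· ≤ c ⊓ b)⟩, hle1.trans inf_le_right,
    hle2.trans inf_le_right, Subtype.ext (le_antisymm (hct.trans (Finset.sup_le fun x hx => ?_))
      (sup_le (hle1.trans inf_le_left) (hle2.trans inf_le_left)))⟩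
  rcases (htT hx).2 with hx' | hx'
  · exact (Finset.le_sup (f := id) (Finset.mem_filter.2 ⟨hx, hx'⟩)).trans le_sup_left
  · exact (Finset.le_sup (f := id) (Finset.mem_filter.2 ⟨hx, hx'⟩)).trans le_sup_right

/-- The compact elements below a given element. -/
def compactIdeal (a : L) : Order.Ideal (CompactElements L) where
  carrier := {k | k.1 ≤ a}
  lower' _ _ hkl hk := le_trans hkl hk
  nonempty' := ⟨⊥, bot_le⟩
  directed' k hk l hl := ⟨k ⊔ l, sup_le hk hl, le_sup_left, le_sup_right⟩

theorem compactIdeal_surjective : Function.Surjective (compactIdeal (L := L)) := by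
  intro J
  refine ⟨sSup (Subtype.val '' (J : Set (CompactElements L))), le_antisymm (fun k hk => ?_)
    fun k hk => le_sSup ⟨k, hk, rfl⟩⟩
  obtain ⟨x, ⟨j, hj, rfl⟩, hkx⟩ :=
    (CompleteLattice.isCompactElement_iff_le_of_directed_sSup_le L k.1).1 k.2 _
      (J.nonempty'.image _) (by
        rintro _ ⟨i, hi, rfl⟩ _ ⟨j, hj, rfl⟩
        exact ⟨_, ⟨i ⊔ j, Order.Ideal.sup_mem hi hj, rfl⟩, (le_sup_left : i ≤ i ⊔ j),
          (le_sup_right : j ≤ i ⊔ j)⟩) hk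
  exact J.lower hkx hj

/-- A compactly generated lattice is the ideal lattice of its semilattice of compact elements. -/
noncomputable def compactIdealIso [IsCompactlyGenerated L] : L ≃o Order.Ideal (CompactElements L) :=
  RelIso.ofSurjective
    (OrderEmbedding.ofMapLEIff compactIdeal fun a _ =>
      ⟨fun h => le_iff_compact_le_imp.2 fun c hc hca =>
        h (show (⟨c, hc⟩ : CompactElements L) ∈ compactIdeal a from hca),
        fun h _ hk => le_trans hk h⟩)
    compactIdeal_surjective

end CompactElements

/-! ### Automorphisms of the chain of rationals. -/

namespace OrderIso

section Lattice

variable {α : Type*} [LinearOrder α]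

instance : PartialOrder (α ≃o α) :=
  PartialOrder.lift (fun f : α ≃o α => (f : α → α)) DFunLike.coe_injective

theorem le_iff_forall {f g : α ≃o α} : f ≤ g ↔ ∀ x, f x ≤ g x := Iff.rfl

/-- The pointwise maximum of two automorphisms of a chain. -/
def autSup (f g : α ≃o α) : α ≃o α :=
  StrictMono.orderIsoOfRightInverse (fun x => f x ⊔ g x)
    (fun _ _ h => max_lt_max (f.strictMono h) (g.strictMono h))
    (fun y => f.symm y ⊓ g.symm y) (by
      intro y
      rcases le_total (f.symm y) (g.symm y) with h | h
      · simpa [inf_eq_left.2 h] using (g.le_symm_apply).1 h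
      · simpa [inf_eq_right.2 h] using (f.le_symm_apply).1 h)

/-- The pointwise minimum of two automorphisms of a chain. -/
def autInf (f g : α ≃o α) : α ≃o α :=
  StrictMono.orderIsoOfRightInverse (fun x => f x ⊓ g x)
    (fun _ _ h => min_lt_min (f.strictMono h) (g.strictMono h))
    (fun y => f.symm y ⊔ g.symm y) (by
      intro y
      rcases le_total (f.symm y) (g.symm y) with h | h
      · simpa [sup_eq_right.2 h] using (f.symm_apply_le).1 h
      · simpa [sup_eq_left.2 h] using (g.symm_apply_le).1 h)

/-- The automorphisms of a chain are ordered pointwise. -/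
instance : Lattice (α ≃o α) where
  sup := autSup
  inf := autInf
  le_sup_left _ _ _ := le_sup_left
  le_sup_right _ _ _ := le_sup_right
  sup_le _ _ _ h h' x := sup_le (h x) (h' x)
  inf_le_left _ _ _ := inf_le_left
  inf_le_right _ _ _ := inf_le_right
  le_inf _ _ _ h h' x := le_inf (h x) (h' x)

theorem aut_sup_apply (f g : α ≃o α) (x : α) : (f ⊔ g) x = f x ⊔ g x := rfl

theorem aut_inf_apply (f g : α ≃o α) (x : α) : (f ⊓ g) x = f x ⊓ g x := rfl

instance : MulLeftMono (α ≃o α) := ⟨fun f _ _ h x => f.monotone (h x)⟩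

instance : MulRightMono (α ≃o α) := ⟨fun f _ _ h x => h (f x)⟩

/-- The automorphisms fixing all points outside of some bounded interval. -/
def boundedAut (α : Type*) [LinearOrder α] [Nonempty α] : Subgroup (α ≃o α) where
  carrier := {f | ∃ a b, ∀ x, x ≤ a ∨ b ≤ x → f x = x}
  one_mem' := ⟨Classical.arbitrary α, Classical.arbitrary α, fun _ _ => rfl⟩
  mul_mem' := by
    rintro f g ⟨a, b, h⟩ ⟨a', b', h'⟩
    refine ⟨a ⊓ a', b ⊔ b', fun x hx => ?_⟩
    rw [RelIso.mul_apply, h' x, h x]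
    · exact hx.imp (fun h => h.trans inf_le_left) fun h => le_sup_left.trans h
    · exact hx.imp (fun h => h.trans inf_le_right) fun h => le_sup_right.trans h
  inv_mem' := by
    rintro f ⟨a, b, h⟩
    exact ⟨a, b, fun x hx => f.symm_apply_eq.2 (h x hx).symm⟩

variable [Nonempty α]

theorem sup_mem_boundedAut {f g : α ≃o α} (hf : f ∈ boundedAut α) (hg : g ∈ boundedAut α) :
    f ⊔ g ∈ boundedAut α := by
  obtain ⟨a, b, h⟩ := hf
  obtain ⟨a', b', h'⟩ := hg
  refine ⟨a ⊓ a', b ⊔ b', fun x hx => ?_⟩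
  rw [aut_sup_apply, h' x, h x, sup_idem]
  · exact hx.imp (fun h => h.trans inf_le_left) fun h => le_sup_left.trans h
  · exact hx.imp (fun h => h.trans inf_le_right) fun h => le_sup_right.trans h

theorem inf_mem_boundedAut {f g : α ≃o α} (hf : f ∈ boundedAut α) (hg : g ∈ boundedAut α) :
    f ⊓ g ∈ boundedAut α := by
  obtain ⟨a, b, h⟩ := hf
  obtain ⟨a', b', h'⟩ := hg
  refine ⟨a ⊓ a', b ⊔ b', fun x hx => ?_⟩
  rw [aut_inf_apply, h' x, h x, inf_idem]
  · exact hx.imp (fun h => h.trans inf_le_left) fun h => le_sup_left.trans h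
  · exact hx.imp (fun h => h.trans inf_le_right) fun h => le_sup_right.trans h

end Lattice

/-- The affine automorphism of `ℚ` with slope `r` sending `a` to `b`. -/
def affineAut (a b r : ℚ) (hr : 0 < r) : ℚ ≃o ℚ :=
  StrictMono.orderIsoOfRightInverse (fun x => b + r * (x - a))
    (fun x y h => by
      have := mul_lt_mul_of_pos_left h hr
      dsimp only
      linarith)
    (fun y => a + (y - b) / r) (fun y => by field_simp; ring)

theorem affineAut_apply (a b r : ℚ) (hr : 0 < r) (x : ℚ) :
    affineAut a b r hr x = b + r * (x - a) := rfl

/-- Two lines through `(b, b')` are used: one of slope at least 1 through `(a, a)`, one of slope at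
most 1 through `(m, m)`. Their minimum lies below the diagonal outside `[a, m]`, so its maximum with
the identity is the required map. -/
theorem exists_boundedAut_fix_move {a b b' m : ℚ} (hab : a < b) (hbb' : b ≤ b') (hm : b' < m) :
    ∃ f ∈ boundedAut ℚ, (∀ x, x ≤ a ∨ m ≤ x → f x = x) ∧ f b = b' := by
  have hr : 0 < (b' - a) / (b - a) := div_pos (by linarith) (by linarith)
  have hr' : 0 < (m - b') / (m - b) := div_pos (by linarith) (by linarith)
  have hr1 : 1 ≤ (b' - a) / (b - a) := (one_le_div (by linarith)).2 (by linarith)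
  have hr1' : (m - b') / (m - b) ≤ 1 := (div_le_one (by linarith)).2 (by linarith)
  have key : ∀ x, x ≤ a ∨ m ≤ x →
      (1 ⊔ (affineAut a a _ hr ⊓ affineAut m m _ hr')) x = x := by
    intro x hx
    rw [aut_sup_apply, aut_inf_apply, affineAut_apply, affineAut_apply, RelIso.one_apply,
      sup_eq_left]
    rcases hx with hx | hx
    · refine inf_le_left.trans ?_
      nlinarith [mul_nonneg (sub_nonneg.2 hr1) (sub_nonneg.2 hx)]
    · refine inf_le_right.trans ?_
      nlinarith [mul_nonneg (sub_nonneg.2 hr1') (sub_nonneg.2 hx)]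
  refine ⟨1 ⊔ (affineAut a a _ hr ⊓ affineAut m m _ hr'), ⟨a, m, key⟩, key, ?_⟩
  have h1 : a + (b' - a) / (b - a) * (b - a) = b' := by
    rw [div_mul_cancel₀ _ (by linarith)]; ring
  have h2 : m + (m - b') / (m - b) * (b - m) = b' := by
    rw [← neg_sub m b, mul_neg, div_mul_cancel₀ _ (by linarith)]; ring
  rw [aut_sup_apply, aut_inf_apply, affineAut_apply, affineAut_apply, RelIso.one_apply, h1, h2,
    inf_idem, sup_eq_right]
  exact hbb'

theorem exists_boundedAut_stretch {a b : ℚ} (hab : a < b) (c d : ℚ) :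
    ∃ f ∈ boundedAut ℚ, f a ≤ c ∧ d ≤ f b := by
  set c' := min c a - 1
  have hca : c' < a := by have := min_le_right c a; linarith
  have hcc : c' ≤ c := by have := min_le_left c a; linarith
  obtain ⟨f, hf, hfix, hfa⟩ :=
    exists_boundedAut_fix_move (a := c' - 1) (b := c') (b' := a) (m := b)
      (by linarith) hca.le hab
  obtain ⟨g, hg, hgix, hgb⟩ :=
    exists_boundedAut_fix_move (a := c') (b := b) (b' := max b d) (m := max b d + 1)
      (by linarith) (le_max_left _ _) (by linarith)
  -- `f⁻¹` pulls `a` down to `c'` and fixes `b`; then `g` fixes `c'` and pushes `b` up to `max b d`.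
  refine ⟨g * f⁻¹, mul_mem hg (inv_mem hf), ?_, ?_⟩
  · have : f⁻¹ a = c' := f.symm_apply_eq.2 hfa.symm
    rw [RelIso.mul_apply, this, hgix _ (.inl le_rfl)]
    exact hcc
  · have : f⁻¹ b = b := f.symm_apply_eq.2 (hfix b (.inr le_rfl)).symm
    rw [RelIso.mul_apply, this, hgb]
    exact le_max_right _ _

theorem exists_lt_mabs_apply {α : Type*} [LinearOrder α] {g : α ≃o α} (hg : g ≠ 1) :
    ∃ a, a < |g|ₘ a := by
  obtain ⟨a, ha⟩ : ∃ a, g a ≠ a := by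
    by_contra! h
    exact hg (RelIso.ext h)
  refine ⟨a, ?_⟩
  change a < g a ⊔ g.symm a
  rcases ha.lt_or_gt with h | h
  · exact lt_sup_of_lt_right (g.lt_symm_apply.2 h)
  · exact lt_sup_of_lt_left h

/-- Bounded automorphisms of `ℚ` are dominated by conjugates of any nontrivial automorphism. -/
theorem exists_boundedAut_mabs_le_conj {g h : ℚ ≃o ℚ} (hg : g ≠ 1) (hh : h ∈ boundedAut ℚ) :
    ∃ f ∈ boundedAut ℚ, |h|ₘ ≤ f * |g|ₘ * f⁻¹ := by
  obtain ⟨a, ha⟩ := exists_lt_mabs_apply hg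
  obtain ⟨c, d, hk⟩ : |h|ₘ ∈ boundedAut ℚ := sup_mem_boundedAut hh (inv_mem hh)
  obtain ⟨f, hf, hfc, hfd⟩ := exists_boundedAut_stretch ha c d
  refine ⟨f, hf, le_iff_forall.2 fun x => ?_⟩
  rcases le_or_gt x c with hx | hx
  · rw [hk x (.inl hx)]
    exact f.symm_apply_le.1 (one_le_mabs g _)
  rcases le_or_gt d x with hx' | hx'
  · rw [hk x (.inr hx')]
    exact f.symm_apply_le.1 (one_le_mabs g _)
  -- Between `c` and `d`, `|h|ₘ` cannot exceed `d`, while `f a ≤ c ≤ x` and `d ≤ f (|g|ₘ a)` force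
  -- the conjugate to reach `d`.
  calc |h|ₘ x ≤ |h|ₘ d := (|h|ₘ).monotone hx'.le
    _ = d := hk d (.inr le_rfl)
    _ ≤ f (|g|ₘ a) := hfd
    _ ≤ f (|g|ₘ (f.symm x)) :=
      f.monotone ((|g|ₘ).monotone (f.le_symm_apply.2 (hfc.trans hx.le)))

theorem exists_boundedAut_ne_one : ∃ f ∈ boundedAut ℚ, f ≠ 1 := by
  obtain ⟨f, hf, -, h⟩ := exists_boundedAut_fix_move (a := 0) (b := 1) (b' := 2) (m := 3)
    (by norm_num) (by norm_num) (by norm_num)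
  refine ⟨f, hf, ?_⟩
  rintro rfl
  rw [RelIso.one_apply] at h
  norm_num at h

/-- Families of automorphisms of a chain act fibrewise on a lexicographic product. -/
def lexAut {α β : Type*} [LinearOrder α] [LinearOrder β] (g : α → (β ≃o β)) :
    α ×ₗ β ≃o α ×ₗ β :=
  StrictMono.orderIsoOfRightInverse
    (fun p => toLex ((ofLex p).1, g (ofLex p).1 (ofLex p).2))
    (fun p q h => by
      rw [Prod.Lex.toLex_lt_toLex]
      rcases Prod.Lex.lt_iff.1 h with h | ⟨h, h'⟩
      · exact .inl h
      · exact .inr ⟨h, by dsimp only; rw [h]; exact (g _).strictMono h'⟩)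
    (fun p => toLex ((ofLex p).1, (g (ofLex p).1).symm (ofLex p).2))
    (fun p => by simp)

end OrderIso

open OrderIso

/-- The points `1 / (n + 1)` are distinguished by their denominators. Labels are kept in a bounded
interval so that an action on the labelled fibres is bounded. -/
theorem exists_surjective_unitInterval (S : Type u) [Countable S] [Nonempty S] :
    ∃ p : ℚ → S, ∀ s, ∃ q, (0 ≤ q ∧ q ≤ 1) ∧ p q = s := by
  obtain ⟨t, ht⟩ := exists_surjective_nat S
  refine ⟨fun q => t (q.den - 1), fun s => ?_⟩
  obtain ⟨n, rfl⟩ := ht s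
  refine ⟨((n + 1 : ℕ) : ℚ)⁻¹, ⟨by positivity, ?_⟩, ?_⟩
  · exact inv_le_one_of_one_le₀ (by push_cast; linarith [n.cast_nonneg (α := ℚ)])
  · dsimp only
    rw [Rat.inv_natCast_den, if_neg n.succ_ne_zero, Nat.add_sub_cancel]

/-- A countable power of the `ℓ`-group of automorphisms of `ℚ` embeds into the `ℓ`-group of
bounded automorphisms of `ℚ`. -/
theorem exists_embedding_pi_boundedAut (S : Type u) [Countable S] [Nonempty S] :
    ∃ φ : (S → (ℚ ≃o ℚ)) →* (ℚ ≃o ℚ), Function.Injective φ ∧ (∀ x, φ x ∈ boundedAut ℚ) ∧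
      (∀ x y, φ (x ⊔ y) = φ x ⊔ φ y) ∧ ∀ x y, φ (x ⊓ y) = φ x ⊓ φ y := by
  classical
  obtain ⟨p, hp⟩ := exists_surjective_unitInterval S
  -- By Cantor's theorem the lexicographic square is isomorphic to `ℚ`. Each fibre over the unit
  -- interval carries the coordinate named by its label; all other fibres are fixed.
  have : Countable (ℚ ×ₗ ℚ) := inferInstanceAs (Countable (ℚ × ℚ))
  obtain ⟨e⟩ := Order.iso_of_countable_dense (ℚ ×ₗ ℚ) ℚ
  let γ (x : S → (ℚ ≃o ℚ)) (q : ℚ) : ℚ ≃o ℚ := if 0 ≤ q ∧ q ≤ 1 then x (p q) else 1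
  let ψ (x : S → (ℚ ≃o ℚ)) : ℚ ≃o ℚ := e.symm.trans ((lexAut (γ x)).trans e)
  have hψ (x r) : ψ x r = e (toLex ((ofLex (e.symm r)).1,
    γ x (ofLex (e.symm r)).1 (ofLex (e.symm r)).2)) := rfl
  have hγmul (x y q) : γ (x * y) q = γ x q * γ y q := by
    by_cases h : 0 ≤ q ∧ q ≤ 1 <;> simp [γ, h]
  have hγsup (x y q) : γ (x ⊔ y) q = γ x q ⊔ γ y q := by
    by_cases h : 0 ≤ q ∧ q ≤ 1 <;> simp [γ, h]
  have hγinf (x y q) : γ (x ⊓ y) q = γ x q ⊓ γ y q := by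
    by_cases h : 0 ≤ q ∧ q ≤ 1 <;> simp [γ, h]
  have hmono (q : ℚ) : Monotone fun r : ℚ => e (toLex (q, r)) := fun r s h =>
    e.monotone (Prod.Lex.toLex_le_toLex.2 (.inr ⟨rfl, h⟩))
  refine ⟨MonoidHom.mk' ψ fun x y => ?_, ?_, fun x => ?_, fun x y => ?_, fun x y => ?_⟩
  · refine RelIso.ext fun r => ?_
    rw [RelIso.mul_apply, hψ, hψ, hψ, hγmul]
    simp
  · refine (injective_iff_map_eq_one _).2 fun x hx => funext fun s => RelIso.ext fun r => ?_
    obtain ⟨q, hq, rfl⟩ := hp s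
    have h : ψ x (e (toLex (q, r))) = e (toLex (q, r)) := by
      rw [show ψ x = 1 from hx]; rfl
    rw [hψ] at h
    simpa [γ, hq] using h
  -- Any points in fibres on either side of the unit interval serve as bounds.
  · refine ⟨e (toLex (-1, 0)), e (toLex (2, 0)), fun r hr => ?_⟩
    have h : ¬ (0 ≤ (ofLex (e.symm r)).1 ∧ (ofLex (e.symm r)).1 ≤ 1) := by
      rintro ⟨h0, h1⟩
      rcases hr with hr | hr
      · have := Prod.Lex.monotone_fst_ofLex (e.symm_apply_le.2 hr)
        simp at this
        linarith
      · have := Prod.Lex.monotone_fst_ofLex (e.le_symm_apply.2 hr)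
        simp at this
        linarith
    change ψ x r = r
    simp [hψ, γ, h]
  · refine RelIso.ext fun r => ?_
    change ψ _ r = ψ x r ⊔ ψ y r
    rw [hψ, hγsup, aut_sup_apply]
    exact (hmono _).map_sup _ _
  · refine RelIso.ext fun r => ?_
    change ψ _ r = ψ x r ⊓ ψ y r
    rw [hψ, hγinf, aut_inf_apply]
    exact (hmono _).map_inf _ _

/-! ### Refinement in distributive semilattices. -/

section Refinement

variable {S : Type u} [SemilatticeSup S] [OrderBot S]

theorem IsDistribSemilattice.exists_sup_eq (hS : IsDistribSemilattice S) (Y : Finset S) (x : S)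
    (h : x ≤ Y.sup id) : ∃ u : S → S, (∀ y ∈ Y, u y ≤ y) ∧ Y.sup u = x := by
  classical
  induction Y using Finset.induction_on generalizing x with
  | empty => exact ⟨id, by simp, by simpa using (le_bot_iff.1 h).symm⟩
  | insert y Y hy ih =>
    rw [Finset.sup_insert] at h
    obtain ⟨a, b, ha, hb, rfl⟩ := hS _ _ _ h
    obtain ⟨u, hu, rfl⟩ := ih b hb
    refine ⟨Function.update u y a, fun z hz => ?_, ?_⟩
    · rcases Finset.mem_insert.1 hz with rfl | hz
      · simpa using ha
      · rw [Function.update_of_ne (ne_of_mem_of_not_mem hz hy)]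
        exact hu z hz
    · rw [Finset.sup_insert, Function.update_self]
      congr 1
      exact Finset.sup_congr rfl fun z hz =>
        Function.update_of_ne (ne_of_mem_of_not_mem hz hy) _ _

variable [DecidableEq S]

/-- Writing each element of `X` as a join of elements below those of `Y`, and splitting the elements
of `Y` accordingly, turns an inequality of joins into an inclusion of index sets. -/
theorem IsDistribSemilattice.exists_refinement_pair (hS : IsDistribSemilattice S) (X Y : Finset S)
    (h : X.sup id ≤ Y.sup id) :
    ∃ R : S → Finset S, (∀ i, (R i).sup id = i) ∧ X.biUnion R ⊆ Y.biUnion R := by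
  have hx : ∀ x ∈ X, x ≤ Y.sup id := fun x hx => (Finset.le_sup (f := id) hx).trans h
  have : ∀ x, ∃ u : S → S, x ∈ X → (∀ y ∈ Y, u y ≤ y) ∧ Y.sup u = x := fun x => by
    by_cases hxX : x ∈ X
    · obtain ⟨u, hu⟩ := hS.exists_sup_eq Y x (hx x hxX)
      exact ⟨u, fun _ => hu⟩
    · exact ⟨id, fun h => absurd h hxX⟩
  choose u hu using this
  -- An element of `Y` stays among its own pieces, so adding the pieces `u x i ≤ i` leaves its join
  -- unchanged. For elements of both sets the `Y` clause takes precedence, and the inclusion is then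
  -- immediate.
  refine ⟨fun i => if i ∈ Y then insert i (X.image fun x => u x i)
    else if i ∈ X then Y.image (u i) else {i}, fun i => ?_, ?_⟩
  · dsimp only
    split_ifs with hY hX
    · rw [Finset.sup_insert, Finset.sup_image]
      exact sup_eq_left.2 (Finset.sup_le fun x hx => (hu x hx).1 i hY)
    · rw [Finset.sup_image]
      exact (hu i hX).2
    · exact Finset.sup_singleton
  · refine Finset.biUnion_subset.2 fun x hxX => ?_
    by_cases hxY : x ∈ Y
    · exact Finset.subset_biUnion_of_mem
        (fun i => if i ∈ Y then insert i (X.image fun x => u x i)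
          else if i ∈ X then Y.image (u i) else {i}) hxY
    · intro z hz
      rw [if_neg hxY, if_pos hxX, Finset.mem_image] at hz
      obtain ⟨y, hy, rfl⟩ := hz
      refine Finset.mem_biUnion.2 ⟨y, hy, ?_⟩
      rw [if_pos hy]
      exact Finset.mem_insert_of_mem (Finset.mem_image_of_mem (fun x => u x y) hxX)

theorem sup_biUnion_eq {R : S → Finset S} (hR : ∀ i, (R i).sup id = i) (X : Finset S) :
    (X.biUnion R).sup id = X.sup id := by
  rw [Finset.sup_biUnion]
  exact Finset.sup_congr rfl fun i _ => hR i

/-- Inequalities are treated one at a time: splitting preserves joins, so the next inequality still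
holds between the split sets, and inclusions already obtained survive further splitting. -/
theorem IsDistribSemilattice.exists_refinement_finset (hS : IsDistribSemilattice S)
    (T : Finset (Finset S × Finset S)) :
    ∃ R : S → Finset S, (∀ i, (R i).sup id = i) ∧
      ∀ P ∈ T, P.1.sup id ≤ P.2.sup id → P.1.biUnion R ⊆ P.2.biUnion R := by
  induction T using Finset.induction_on with
  | empty => exact ⟨fun i => {i}, fun i => Finset.sup_singleton, by simp⟩
  | insert P T hP ih =>
    obtain ⟨R, hR, hRT⟩ := ih
    by_cases h : P.1.sup id ≤ P.2.sup id
    · obtain ⟨R', hR', hRR⟩ := hS.exists_refinement_pair (P.1.biUnion R) (P.2.biUnion R)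
        (by rwa [sup_biUnion_eq hR, sup_biUnion_eq hR])
      refine ⟨fun i => (R i).biUnion R', fun i => by rw [sup_biUnion_eq hR', hR],
        fun Q hQ hle => ?_⟩
      rw [← Finset.biUnion_biUnion, ← Finset.biUnion_biUnion]
      rcases Finset.mem_insert.1 hQ with rfl | hQ
      · exact hRR
      · exact Finset.biUnion_subset_biUnion_of_subset_left _ (hRT Q hQ hle)
    · refine ⟨R, hR, fun Q hQ hle => ?_⟩
      rcases Finset.mem_insert.1 hQ with rfl | hQ
      · exact absurd hle h
      · exact hRT Q hQ hle

theorem IsDistribSemilattice.exists_refinement (hS : IsDistribSemilattice S) (F : Finset S) :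
    ∃ R : S → Finset S, (∀ i, (R i).sup id = i) ∧
      ∀ X ⊆ F, ∀ Y ⊆ F, X.sup id ≤ Y.sup id → X.biUnion R ⊆ Y.biUnion R := by
  obtain ⟨R, hR, h⟩ := hS.exists_refinement_finset (F.powerset ×ˢ F.powerset)
  exact ⟨R, hR, fun X hX Y hY hle => h (X, Y) (by simp [hX, hY]) hle⟩

end Refinement

/-- A presentation of a semilattice as a limit of finite Boolean semilattices: an element `i` of the
finite set `F k` is split into the elements of `R k i`, and inequalities between joins of elements
of `F k` become inclusions. -/
structure RefinementTower (S : Type u) [SemilatticeSup S] [OrderBot S] [DecidableEq S] where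
  /-- The generators used at a given stage. -/
  F : ℕ → Finset S
  /-- The splitting of the generators at a given stage. -/
  R : ℕ → S → Finset S
  sup_R : ∀ k i, (R k i).sup id = i
  biUnion_subset : ∀ k, (F k).biUnion (R k) ⊆ F (k + 1)
  exists_mem : ∀ s, ∃ k, s ∈ F k
  refines : ∀ k, ∀ X ⊆ F k, ∀ Y ⊆ F k, X.sup id ≤ Y.sup id → X.biUnion (R k) ⊆ Y.biUnion (R k)

theorem IsDistribSemilattice.nonempty_tower {S : Type u} [SemilatticeSup S] [OrderBot S]
    [DecidableEq S] [Countable S] (hS : IsDistribSemilattice S) :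
    Nonempty (RefinementTower S) := by
  obtain ⟨t, ht⟩ := exists_surjective_nat S
  choose R hR hRF using hS.exists_refinement
  -- Stage `k + 1` consists of the pieces of stage `k` together with the `k`-th element of an
  -- enumeration, so every element eventually occurs.
  let F : ℕ → Finset S := fun k =>
    Nat.rec ∅ (fun k (F : Finset S) => insert (t k) (F.biUnion (R F))) k
  refine ⟨⟨F, fun k => R (F k), fun k => hR _, fun k => Finset.subset_insert _ _, fun s => ?_,
    fun k => hRF _⟩⟩
  obtain ⟨k, rfl⟩ := ht s
  exact ⟨k + 1, Finset.mem_insert_self _ _⟩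

/-! ### Order compatibility of products and germs, and the chosen power embedding. -/

open OrderIso Filter

instance Pi.instMulLeftMono {ι : Type*} {M : ι → Type*} [∀ i, Mul (M i)] [∀ i, LE (M i)]
    [∀ i, MulLeftMono (M i)] : MulLeftMono (∀ i, M i) :=
  ⟨fun a _ _ h i => mul_le_mul_right (h i) (a i)⟩

instance Pi.instMulRightMono {ι : Type*} {M : ι → Type*} [∀ i, Mul (M i)] [∀ i, LE (M i)]
    [∀ i, MulRightMono (M i)] : MulRightMono (∀ i, M i) :=
  ⟨fun a _ _ h i => mul_le_mul_left (h i) (a i)⟩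

namespace Filter.Germ

variable {α M : Type*} {l : Filter α} [Mul M] [LE M]

instance [MulLeftMono M] : MulLeftMono (Germ l M) :=
  ⟨fun a b c => inductionOn₃ a b c fun _ _ _ h => h.mono fun _ h => mul_le_mul_right h _⟩

instance [MulRightMono M] : MulRightMono (Germ l M) :=
  ⟨fun a b c => inductionOn₃ a b c fun _ _ _ h => h.mono fun _ h => mul_le_mul_left h _⟩

end Filter.Germ

section PowerEmbedding

variable {S : Type u} [Countable S] [Nonempty S]

variable (S) in
/-- An embedding of a power of the automorphism group of `ℚ` into its bounded part. -/
noncomputable def powerEmbedding : (S → (ℚ ≃o ℚ)) →* (ℚ ≃o ℚ) :=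
  (exists_embedding_pi_boundedAut S).choose

theorem powerEmbedding_injective : Function.Injective (powerEmbedding S) :=
  (exists_embedding_pi_boundedAut S).choose_spec.1

theorem powerEmbedding_mem (x : S → (ℚ ≃o ℚ)) : powerEmbedding S x ∈ boundedAut ℚ :=
  (exists_embedding_pi_boundedAut S).choose_spec.2.1 x

theorem powerEmbedding_sup (x y : S → (ℚ ≃o ℚ)) :
    powerEmbedding S (x ⊔ y) = powerEmbedding S x ⊔ powerEmbedding S y :=
  (exists_embedding_pi_boundedAut S).choose_spec.2.2.1 x y

theorem powerEmbedding_inf (x y : S → (ℚ ≃o ℚ)) :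
    powerEmbedding S (x ⊓ y) = powerEmbedding S x ⊓ powerEmbedding S y :=
  (exists_embedding_pi_boundedAut S).choose_spec.2.2.2 x y

end PowerEmbedding

/-! ### The tower of `ℓ`-groups and its limit. -/

namespace RefinementTower

variable {S : Type u} [SemilatticeSup S] [OrderBot S] [DecidableEq S] (T : RefinementTower S)

/-- The families living at stage `k`. -/
def stage (k : ℕ) : Subgroup (S → (ℚ ≃o ℚ)) where
  carrier := {x | (∀ i, i ∉ T.F k → x i = 1) ∧ ∀ i, x i ∈ boundedAut ℚ}
  one_mem' := ⟨fun _ _ => rfl, fun _ => one_mem _⟩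
  mul_mem' hx hy := ⟨fun i hi => by simp [hx.1 i hi, hy.1 i hi],
    fun i => mul_mem (hx.2 i) (hy.2 i)⟩
  inv_mem' hx := ⟨fun i hi => by simp [hx.1 i hi], fun i => inv_mem (hx.2 i)⟩

variable {T}

theorem sup_mem_stage {k : ℕ} {x y : S → (ℚ ≃o ℚ)} (hx : x ∈ T.stage k) (hy : y ∈ T.stage k) :
    x ⊔ y ∈ T.stage k :=
  ⟨fun i hi => by simp [hx.1 i hi, hy.1 i hi], fun i => sup_mem_boundedAut (hx.2 i) (hy.2 i)⟩

theorem inf_mem_stage {k : ℕ} {x y : S → (ℚ ≃o ℚ)} (hx : x ∈ T.stage k) (hy : y ∈ T.stage k) :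
    x ⊓ y ∈ T.stage k :=
  ⟨fun i hi => by simp [hx.1 i hi, hy.1 i hi], fun i => inf_mem_boundedAut (hx.2 i) (hy.2 i)⟩

variable (T) in
open Classical in
/-- The support of a family at stage `k`. -/
noncomputable def supp (k : ℕ) (x : S → (ℚ ≃o ℚ)) : Finset S := {i ∈ T.F k | x i ≠ 1}

theorem mem_supp {k : ℕ} {x : S → (ℚ ≃o ℚ)} {i : S} : i ∈ T.supp k x ↔ i ∈ T.F k ∧ x i ≠ 1 := by
  simp [supp]

theorem mem_supp_of_mem_stage {k : ℕ} {x : S → (ℚ ≃o ℚ)} (hx : x ∈ T.stage k) {i : S} :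
    i ∈ T.supp k x ↔ x i ≠ 1 := by
  rw [mem_supp, and_iff_right_iff_imp]
  exact fun h => by_contra fun hi => h (hx.1 i hi)

theorem supp_subset (k : ℕ) (x : S → (ℚ ≃o ℚ)) : T.supp k x ⊆ T.F k :=
  fun _ hi => (mem_supp.1 hi).1

/-- Domination is solved in each coordinate separately. The conjugator is taken trivial wherever `y`
is, which keeps it in the stage. -/
theorem exists_stage_mabs_le_conj {k : ℕ} {x y : S → (ℚ ≃o ℚ)} (hy : y ∈ T.stage k)
    (h : ∀ i, x i = 1 → y i = 1) : ∃ f ∈ T.stage k, |y|ₘ ≤ f * |x|ₘ * f⁻¹ := by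
  have : ∀ i, ∃ f ∈ boundedAut ℚ, (y i = 1 → f = 1) ∧ |y i|ₘ ≤ f * |x i|ₘ * f⁻¹ := fun i => by
    by_cases hi : y i = 1
    · refine ⟨1, one_mem _, fun _ => rfl, ?_⟩
      simp [hi]
    · obtain ⟨f, hf, hle⟩ := exists_boundedAut_mabs_le_conj (fun hx => hi (h i hx)) (hy.2 i)
      exact ⟨f, hf, fun h => absurd h hi, hle⟩
  choose f hf hf1 hle using this
  exact ⟨f, ⟨fun i hi => hf1 i (hy.1 i hi), hf⟩, hle⟩

variable [Countable S]

variable (T)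

/-- The transition maps: the component at `j` collects the components at those `i` that have `j`
in their splitting. -/
noncomputable def step (k : ℕ) : (S → (ℚ ≃o ℚ)) →* (S → (ℚ ≃o ℚ)) :=
  MonoidHom.mk' (fun x j => powerEmbedding S fun i => if j ∈ T.R k i then x i else 1)
    fun x y => funext fun j => by
      rw [Pi.mul_apply, ← map_mul]
      congr 1
      funext i
      by_cases h : j ∈ T.R k i <;> simp [h]

theorem step_apply (k : ℕ) (x : S → (ℚ ≃o ℚ)) (j : S) :
    T.step k x j = powerEmbedding S fun i => if j ∈ T.R k i then x i else 1 := rfl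

theorem step_apply_eq_one {k : ℕ} {x : S → (ℚ ≃o ℚ)} {j : S} :
    T.step k x j = 1 ↔ ∀ i, j ∈ T.R k i → x i = 1 := by
  rw [step_apply, map_eq_one_iff _ powerEmbedding_injective, funext_iff]
  refine forall_congr' fun i => ?_
  by_cases h : j ∈ T.R k i <;> simp [h]

theorem step_sup (k : ℕ) (x y : S → (ℚ ≃o ℚ)) : T.step k (x ⊔ y) = T.step k x ⊔ T.step k y := by
  funext j
  rw [Pi.sup_apply, step_apply, step_apply, step_apply, ← powerEmbedding_sup]
  congr 1
  funext i
  by_cases h : j ∈ T.R k i <;> simp [h]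

theorem step_inf (k : ℕ) (x y : S → (ℚ ≃o ℚ)) : T.step k (x ⊓ y) = T.step k x ⊓ T.step k y := by
  funext j
  rw [Pi.inf_apply, step_apply, step_apply, step_apply, ← powerEmbedding_inf]
  congr 1
  funext i
  by_cases h : j ∈ T.R k i <;> simp [h]

theorem step_mono (k : ℕ) : Monotone (T.step k) := fun x y h => by
  rw [← sup_eq_right, ← step_sup, sup_eq_right.2 h]

theorem step_mabs (k : ℕ) (x : S → (ℚ ≃o ℚ)) : T.step k |x|ₘ = |T.step k x|ₘ := by
  rw [mabs, step_sup, map_inv, mabs]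

variable {T}

theorem step_mem_stage {k : ℕ} {x : S → (ℚ ≃o ℚ)} (hx : x ∈ T.stage k) :
    T.step k x ∈ T.stage (k + 1) := by
  refine ⟨fun j hj => T.step_apply_eq_one.2 fun i hi => hx.1 i fun hiF => hj ?_,
    fun j => powerEmbedding_mem _⟩
  exact T.biUnion_subset k (Finset.mem_biUnion.2 ⟨i, hiF, hi⟩)

/-- A sequence is compatible at `k` if it lives at stage `k` and moves on by the transition map. -/
def Compatible (T : RefinementTower S) (x : ℕ → S → (ℚ ≃o ℚ)) (k : ℕ) : Prop :=
  x k ∈ T.stage k ∧ x (k + 1) = T.step k (x k)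

variable (T) in
/-- The limit of the tower, as germs of eventually compatible sequences. -/
def limitSubgroup : Subgroup (Germ (atTop : Filter ℕ) (S → (ℚ ≃o ℚ))) where
  carrier := {γ | ∃ x : ℕ → S → (ℚ ≃o ℚ), (x : Germ atTop _) = γ ∧ ∀ᶠ k in atTop, T.Compatible x k}
  one_mem' := ⟨1, rfl, .of_forall fun k => ⟨one_mem _, (map_one _).symm⟩⟩
  mul_mem' := by
    rintro _ _ ⟨x, rfl, hx⟩ ⟨y, rfl, hy⟩
    refine ⟨x * y, rfl, ?_⟩
    filter_upwards [hx, hy] with k hx hy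
    exact ⟨mul_mem hx.1 hy.1, by simp [hx.2, hy.2]⟩
  inv_mem' := by
    rintro _ ⟨x, rfl, hx⟩
    refine ⟨x⁻¹, rfl, ?_⟩
    filter_upwards [hx] with k hx
    exact ⟨inv_mem hx.1, by simp [hx.2]⟩

variable (T) in
/-- The limit `ℓ`-group of the tower. -/
def Limit : Type u := T.limitSubgroup

noncomputable instance : Group T.Limit := inferInstanceAs (Group T.limitSubgroup)

instance : Lattice T.Limit :=
  Subtype.lattice (P := fun γ => γ ∈ T.limitSubgroup)
    (by
      rintro _ _ ⟨x, rfl, hx⟩ ⟨y, rfl, hy⟩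
      refine ⟨x ⊔ y, rfl, ?_⟩
      filter_upwards [hx, hy] with k hx hy
      exact ⟨sup_mem_stage hx.1 hy.1, by simp [hx.2, hy.2, step_sup]⟩)
    (by
      rintro _ _ ⟨x, rfl, hx⟩ ⟨y, rfl, hy⟩
      refine ⟨x ⊓ y, rfl, ?_⟩
      filter_upwards [hx, hy] with k hx hy
      exact ⟨inf_mem_stage hx.1 hy.1, by simp [hx.2, hy.2, step_inf]⟩)

instance : MulLeftMono T.Limit :=
  ⟨fun a b c h => mul_le_mul_right (show b.1 ≤ c.1 from h) a.1⟩

instance : MulRightMono T.Limit :=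
  ⟨fun a b c h => mul_le_mul_left (show b.1 ≤ c.1 from h) a.1⟩

/-- A sequence representing an element of the limit. -/
noncomputable def Limit.rep (γ : T.Limit) : ℕ → S → (ℚ ≃o ℚ) := γ.2.choose

theorem Limit.coe_rep (γ : T.Limit) : (γ.rep : Germ atTop _) = γ.1 := γ.2.choose_spec.1

theorem Limit.compatible_rep (γ : T.Limit) : ∀ᶠ k in atTop, T.Compatible γ.rep k :=
  γ.2.choose_spec.2

theorem Limit.rep_eventuallyEq {γ : T.Limit} {x : ℕ → S → (ℚ ≃o ℚ)}
    (h : γ.1 = (x : Germ atTop _)) : γ.rep =ᶠ[atTop] x :=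
  Germ.coe_eq.1 (γ.coe_rep.trans h)

theorem Limit.rep_one : (1 : T.Limit).rep =ᶠ[atTop] 1 := rep_eventuallyEq rfl

theorem Limit.rep_mul (γ δ : T.Limit) : (γ * δ).rep =ᶠ[atTop] γ.rep * δ.rep :=
  rep_eventuallyEq (by rw [Germ.coe_mul, coe_rep, coe_rep]; rfl)

theorem Limit.rep_inv (γ : T.Limit) : γ⁻¹.rep =ᶠ[atTop] γ.rep⁻¹ :=
  rep_eventuallyEq (by rw [Germ.coe_inv, coe_rep]; rfl)

theorem Limit.rep_sup (γ δ : T.Limit) : (γ ⊔ δ).rep =ᶠ[atTop] γ.rep ⊔ δ.rep :=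
  rep_eventuallyEq (by
    change γ.1 ⊔ δ.1 = (γ.rep : Germ atTop _) ⊔ (δ.rep : Germ atTop _)
    rw [coe_rep, coe_rep])

theorem Limit.rep_inf (γ δ : T.Limit) : (γ ⊓ δ).rep =ᶠ[atTop] γ.rep ⊓ δ.rep :=
  rep_eventuallyEq (by
    change γ.1 ⊓ δ.1 = (γ.rep : Germ atTop _) ⊓ (δ.rep : Germ atTop _)
    rw [coe_rep, coe_rep])

theorem Limit.le_iff_rep {γ δ : T.Limit} : γ ≤ δ ↔ ∀ᶠ k in atTop, γ.rep k ≤ δ.rep k := by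
  change γ.1 ≤ δ.1 ↔ _
  rw [← coe_rep γ, ← coe_rep δ, Germ.coe_le]
  rfl

theorem exists_compatible_of_mem_stage {k : ℕ} {x : S → (ℚ ≃o ℚ)} (hx : x ∈ T.stage k) :
    ∃ y : ℕ → S → (ℚ ≃o ℚ), y k = x ∧ ∀ l, k ≤ l → T.Compatible y l := by
  let z : ℕ → S → (ℚ ≃o ℚ) := fun m => Nat.rec x (fun m y => T.step (k + m) y) m
  have hz : ∀ m, z m ∈ T.stage (k + m) := fun m => by
    induction m with
    | zero => exact hx
    | succ m ih => exact step_mem_stage ih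
  -- Truncated subtraction gives the irrelevant value `x` at indices below `k`.
  refine ⟨fun l => z (l - k), by simp [z], fun l hl => ?_⟩
  obtain ⟨m, rfl⟩ := Nat.exists_eq_add_of_le hl
  constructor
  · simpa using hz m
  · simp [add_assoc, z]

/-- The element of the limit given by a family at stage `k`. -/
theorem exists_limit_rep_eq {k : ℕ} {x : S → (ℚ ≃o ℚ)} (hx : x ∈ T.stage k) :
    ∃ (γ : T.Limit) (y : ℕ → S → (ℚ ≃o ℚ)), γ.rep =ᶠ[atTop] y ∧ y k = x ∧
      ∀ l, k ≤ l → T.Compatible y l := by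
  obtain ⟨y, hy, hc⟩ := exists_compatible_of_mem_stage hx
  exact ⟨⟨y, y, rfl, eventually_atTop.2 ⟨k, hc⟩⟩, y, Limit.rep_eventuallyEq rfl, hy, hc⟩

/-- Since the power embedding is injective, the component at `j` is nontrivial exactly when some
component it collects is; no part of the support is lost. -/
theorem supp_step {k : ℕ} {x : S → (ℚ ≃o ℚ)} (hx : x ∈ T.stage k) :
    T.supp (k + 1) (T.step k x) = (T.supp k x).biUnion (T.R k) := by
  ext j
  rw [mem_supp_of_mem_stage (step_mem_stage hx), Ne, step_apply_eq_one, Finset.mem_biUnion]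
  push Not
  refine exists_congr fun i => ?_
  rw [mem_supp_of_mem_stage hx, and_comm]

theorem sup_supp_eq {x : ℕ → S → (ℚ ≃o ℚ)} {k l : ℕ} (hkl : k ≤ l)
    (h : ∀ l, k ≤ l → T.Compatible x l) :
    (T.supp l (x l)).sup id = (T.supp k (x k)).sup id := by
  induction l, hkl using Nat.le_induction with
  | base => rfl
  | succ l hl ih => rw [(h l hl).2, supp_step (h l hl).1, sup_biUnion_eq (T.sup_R l), ih]

theorem Limit.exists_eventually_sup_supp (γ : T.Limit) :
    ∃ s, ∀ᶠ k in atTop, (T.supp k (γ.rep k)).sup id = s := by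
  obtain ⟨k, hk⟩ := eventually_atTop.1 γ.compatible_rep
  exact ⟨_, eventually_atTop.2 ⟨k, fun l hl => sup_supp_eq hl hk⟩⟩

/-- The eventual join of the supports. -/
noncomputable def Limit.value (γ : T.Limit) : S := γ.exists_eventually_sup_supp.choose

theorem Limit.eventually_value (γ : T.Limit) :
    ∀ᶠ k in atTop, (T.supp k (γ.rep k)).sup id = γ.value :=
  γ.exists_eventually_sup_supp.choose_spec

/-- This reduces the `ℓ`-ideal axioms for the valuation to coordinates: a coordinate where both
inputs are trivial must be trivial in the output. -/
theorem Limit.value_le {γ δ ε : T.Limit}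
    (h : ∀ᶠ k in atTop, ∀ i, γ.rep k i = 1 → δ.rep k i = 1 → ε.rep k i = 1) :
    ε.value ≤ γ.value ⊔ δ.value := by
  obtain ⟨k, hk, h1, h2, h3⟩ :=
    (h.and (γ.eventually_value.and (δ.eventually_value.and ε.eventually_value))).exists
  rw [← h1, ← h2, ← h3, ← Finset.sup_union]
  refine Finset.sup_mono fun i hi => ?_
  rw [mem_supp] at hi
  rw [Finset.mem_union, mem_supp, mem_supp]
  by_contra hcon
  have := hk i
  tauto

/-- A family with `s` as its only nontrivial coordinate has support join `s`, and later stages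
preserve that join. -/
theorem Limit.value_surjective : Function.Surjective (Limit.value (T := T)) := by
  intro s
  obtain ⟨k, hk⟩ := T.exists_mem s
  obtain ⟨f, hf, hf1⟩ := exists_boundedAut_ne_one
  have hx : Pi.mulSingle s f ∈ T.stage k := by
    constructor
    · intro i hi
      exact Pi.mulSingle_eq_of_ne (ne_of_mem_of_not_mem hk hi).symm _
    · intro i
      by_cases h : i = s
      · subst h; simpa using hf
      · rw [Pi.mulSingle_eq_of_ne h]; exact one_mem _
  obtain ⟨γ, y, hγ, hy, hc⟩ := exists_limit_rep_eq hx
  refine ⟨γ, ?_⟩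
  obtain ⟨l, h1, h2, hl⟩ := (γ.eventually_value.and (hγ.and (eventually_ge_atTop k))).exists
  rw [← h1, h2, sup_supp_eq hl hc, hy]
  have : T.supp k (Pi.mulSingle s f) = {s} := by
    ext i
    rw [mem_supp_of_mem_stage hx, Finset.mem_singleton]
    by_cases h : i = s
    · subst h; simpa using hf1
    · simp [h]
  rw [this, Finset.sup_singleton, id]

theorem Limit.exists_mabs_le_conj {γ δ : T.Limit} (h : δ.value ≤ γ.value) :
    ∃ f, |δ|ₘ ≤ f * |γ|ₘ * f⁻¹ := by
  obtain ⟨k, hk⟩ := eventually_atTop.1 ((γ.compatible_rep.and δ.compatible_rep).and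
    (γ.eventually_value.and δ.eventually_value))
  obtain ⟨⟨hγ, hδ⟩, hγv, hδv⟩ := hk k le_rfl
  -- At stage `k` only the joins of the supports are comparable; the refinement property makes the
  -- supports themselves comparable one stage later.
  have hsub : T.supp (k + 1) (δ.rep (k + 1)) ⊆ T.supp (k + 1) (γ.rep (k + 1)) := by
    rw [hγ.2, hδ.2, supp_step hγ.1, supp_step hδ.1]
    exact T.refines k _ (supp_subset _ _) _ (supp_subset _ _) (by rwa [hγv, hδv])
  have hγ' := (hk (k + 1) k.le_succ).1.1.1
  have hδ' := (hk (k + 1) k.le_succ).1.2.1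
  obtain ⟨f, hf, hle⟩ := exists_stage_mabs_le_conj (x := γ.rep (k + 1)) hδ' fun i hi => by
    by_contra hne
    exact (mem_supp.1 (hsub ((mem_supp_of_mem_stage hδ').2 hne))).2 hi
  obtain ⟨φ, y, hφ, hy, hc⟩ := exists_limit_rep_eq hf
  -- The inequality found at stage `k + 1` persists because the transition maps are monotone
  -- homomorphisms commuting with absolute values.
  have key : ∀ l, k + 1 ≤ l → |δ.rep l|ₘ ≤ y l * |γ.rep l|ₘ * (y l)⁻¹ := by
    intro l hl
    induction l, hl using Nat.le_induction with
    | base => rwa [hy]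
    | succ l hl ih =>
      have hl' := (hk l (by omega)).1
      rw [hl'.1.2, hl'.2.2, (hc l hl).2, ← step_mabs, ← step_mabs, ← map_inv, ← map_mul, ← map_mul]
      exact T.step_mono l ih
  refine ⟨φ, Limit.le_iff_rep.2 ?_⟩
  filter_upwards [eventually_ge_atTop (k + 1), hφ, rep_sup δ δ⁻¹, rep_sup γ γ⁻¹, rep_inv δ,
    rep_inv γ, rep_mul (φ * |γ|ₘ) φ⁻¹, rep_mul φ |γ|ₘ, rep_inv φ] with l hl h1 h2 h3 h4 h5 h6 h7 h8
  rw [h6, Pi.mul_apply, h7, Pi.mul_apply, h8, Pi.inv_apply, h1, mabs, h2, mabs, h3, Pi.sup_apply,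
    Pi.sup_apply, h4, h5]
  exact key l hl

variable (T) in
/-- The limit of a tower has its `ℓ`-ideals governed by the semilattice. -/
noncomputable def valuation : IdealValuation T.Limit S where
  val := Limit.value
  val_one := by
    obtain ⟨k, h1, h2⟩ := ((1 : T.Limit).eventually_value.and (Limit.rep_one (T := T))).exists
    rw [← h1, h2]
    simp [supp]
  val_mul x y := Limit.value_le <| by
    filter_upwards [Limit.rep_mul x y] with k hk i hx hy
    simp [hk, hx, hy]
  val_inv x := by
    rw [← sup_idem x.value]
    refine Limit.value_le ?_
    filter_upwards [Limit.rep_inv x] with k hk i hx _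
    simp [hk, hx]
  val_conj g x := by
    rw [← sup_idem x.value]
    refine Limit.value_le ?_
    filter_upwards [Limit.rep_mul (g * x) g⁻¹, Limit.rep_mul g x, Limit.rep_inv g]
      with k h1 h2 h3 i hx _
    simp [h1, h2, h3, hx]
  val_sup x y := Limit.value_le <| by
    filter_upwards [Limit.rep_sup x y] with k hk i hx hy
    simp [hk, hx, hy]
  val_inf x y := Limit.value_le <| by
    filter_upwards [Limit.rep_inf x y] with k hk i hx hy
    simp [hk, hx, hy]
  val_convex x y z hxy hyz := Limit.value_le <| by
    filter_upwards [Limit.le_iff_rep.1 hxy, Limit.le_iff_rep.1 hyz] with k h1 h2 i hx hz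
    -- A coordinate squeezed between two identities is the identity.
    exact le_antisymm (hz ▸ h2 i) (hx ▸ h1 i)
  surjective := Limit.value_surjective
  dominated _ _ := Limit.exists_mabs_le_conj

end RefinementTower

/-! ### The representation theorem. -/

theorem theoremT :
    (∀ (S : Type u) [SemilatticeSup S] [OrderBot S] [Countable S],
      IsDistribSemilattice S →
        ∃ (G : Type u) (_ : Group G) (_ : Lattice G) (_ : MulLeftMono G) (_ : MulRightMono G),
          Nonempty (S ≃o LIdeal.FinGen G)) ∧
    (∀ (L : Type u) [CompleteLattice L] [IsCompactlyGenerated L],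
      (∀ a b c : L, a ⊓ (b ⊔ c) = (a ⊓ b) ⊔ (a ⊓ c)) →
      {k : L | IsCompactElement k}.Countable →
        ∃ (G : Type u) (_ : Group G) (_ : Lattice G) (_ : MulLeftMono G) (_ : MulRightMono G),
          Nonempty (L ≃o LIdeal G)) := by
  classical
  constructor
  · intro S _ _ _ hS
    obtain ⟨T⟩ := hS.nonempty_tower
    exact ⟨T.Limit, inferInstance, inferInstance, inferInstance, inferInstance,
      ⟨T.valuation.finGenIso⟩⟩
  · intro L _ _ hL hcount
    have : Countable (CompactElements L) := hcount.to_subtype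
    obtain ⟨T⟩ := (CompactElements.isDistribSemilattice hL).nonempty_tower
    exact ⟨T.Limit, inferInstance, inferInstance, inferInstance, inferInstance,
      ⟨compactIdealIso.trans T.valuation.idealIso⟩⟩
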